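/- Fix $d\in\{1,2,\dots\}$ and let $\mathbb F=\mathbb Z_+\times\{1,\dots,d\}$. All matrices below are indexed by $\mathbb F\times\mathbb F$. For a stochastic matrix $S=(s(k,i;l,j))$ put $S^{\ge}(k,i;l,j)=\sum_{m\ge l}s(k,i;m,j)$. The matrix $S$ is called block-monotone if $S^{\ge}(k,i;l,j)\le S^{\ge}(k+1,i;l,j)$ for all $k,l\in\mathbb Z_+$ and $i,j\in\{1,\dots,d\}$. For stochastic matrices $P_1,P_2$ we write $P_1\prec_d P_2$ ($P_1$ is block-wise dominated by $P_2$) if $P_1^{\ge}\le P_2^{\ge}$ entrywise. A column vector $v=(v(k,i))_{(k,i)\in\mathbb F}$ is block-increasing if $v(k,i)\le v(k+1,i)$ for all $(k,i)\in\mathbb F$. Let $e$ denote the column vector of ones, let $\mathbf 1_0$ denote the indicator column vector of $\{0\}\times\{1,\dots,d\}$, and let $\|x\|=\sum_{(k,i)\in\mathbb F}|x(k,i)|$. For $n\in\{1,2,\dots\}$ the last-column-block-augmented truncation $P_n=(p_n(k,i;l,j))$ of a stochastic matrix $P=(p(k,i;l,j))$ is the stochastic matrix with $p_n(k,i;l,j)=p(k,i;l,j)$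 for $l<n$, $p_n(k,i;n,j)=\sum_{m\ge n}p(k,i;m,j)$, and $p_n(k,i;l,j)=0$ for $l>n$. **Theorem.** Let $P$ be a stochastic matrix (not necessarily block-monotone), and let $\widetilde P$ be an irreducible block-monotone stochastic matrix such that $P\prec_d\widetilde P$. Suppose that there exist a block-increasing real column vector $v$ with $v\ge e$ and constants $\gamma\in(0,1)$, $b\in(0,\infty)$ such that $$\widetilde P v\le\gamma v+b\,\mathbf 1_0 .$$ Let $\pi$ be a stationary probability vector of $P$ and, for $n\in\{1,2,\dots\}$, let $\pi_n$ be a stationary probability vector of $P_n$. Then for all $n,m\in\{1,2,\dots\}$, $$\|\pi_n-\pi\|\le\frac{b}{1-\gamma}\left(4\gamma^m+2m\sum_{i=1}^d\frac1{v(n,i)}\right).$$ -/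

import Mathlib

/-- The state space `ℤ₊ × {1, …, d}` (level, phase); the phases are indexed by `Fin d`. -/
abbrev BlockState (d : ℕ) : Type := ℕ × Fin d

/-- `S` is a stochastic matrix: nonnegative entries, and every row sums to one. -/
def IsStochastic {d : ℕ} (S : Matrix (BlockState d) (BlockState d) ℝ) : Prop :=
  (∀ x y, 0 ≤ S x y) ∧ ∀ x, HasSum (fun y => S x y) 1

/-- `blockTail S x l j = ∑_{m ≥ l} S(x; m, j)`. This is the `(x; l, j)` entry of the product
`S T_d`, where `T_d` is the lower block-triangular matrix whose blocks on and below the diagonal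
are all identity matrices. -/
noncomputable def blockTail {d : ℕ} (S : Matrix (BlockState d) (BlockState d) ℝ)
    (x : BlockState d) (l : ℕ) (j : Fin d) : ℝ :=
  ∑' m : ℕ, S x (l + m, j)

/-- `S` is a block-monotone stochastic matrix with block size `d` (`S ∈ BM_d`). -/
def IsBlockMonotone {d : ℕ} (S : Matrix (BlockState d) (BlockState d) ℝ) : Prop :=
  IsStochastic S ∧
    ∀ (k l : ℕ) (i j : Fin d), blockTail S (k, i) l j ≤ blockTail S (k + 1, i) l j

/-- The stochastic matrix `P₁` is block-wise dominated by `P₂` (`P₁ ≺_d P₂`):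
`P₁ T_d ≤ P₂ T_d` entrywise. -/
def BlockwiseDominated {d : ℕ} (P₁ P₂ : Matrix (BlockState d) (BlockState d) ℝ) : Prop :=
  ∀ (x : BlockState d) (l : ℕ) (j : Fin d), blockTail P₁ x l j ≤ blockTail P₂ x l j

/-- `f` is a block-increasing column vector (`f ∈ BI_d`). -/
def IsBlockIncreasing {d : ℕ} (f : BlockState d → ℝ) : Prop :=
  ∀ (k : ℕ) (i : Fin d), f (k, i) ≤ f (k + 1, i)

/-- The last-column-block-augmented first-`n`-block-column truncation of `P`. -/
noncomputable def lastColumnTruncation {d : ℕ} (n : ℕ)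
    (P : Matrix (BlockState d) (BlockState d) ℝ) : Matrix (BlockState d) (BlockState d) ℝ :=
  fun x y =>
    if y.1 < n then P x y
    else if y.1 = n then blockTail P x n y.2
    else 0

/-- `p` is a stationary probability vector of `S`: it is a probability vector and `p S = p`. -/
def IsStationaryVector {d : ℕ} (S : Matrix (BlockState d) (BlockState d) ℝ)
    (p : BlockState d → ℝ) : Prop :=
  (∀ x, 0 ≤ p x) ∧ HasSum p 1 ∧ ∀ y, HasSum (fun x => p x * S x y) (p y)

/-- The geometric drift condition `S v ≤ γ v + b 1₀`, where `1₀` is the indicator of level `0`;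
the (nonnegative) series defining `S v` are required to converge. -/
def GeometricDrift {d : ℕ} (S : Matrix (BlockState d) (BlockState d) ℝ)
    (v : BlockState d → ℝ) (γ b : ℝ) : Prop :=
  ∀ x, Summable (fun y => S x y * v y) ∧
    ∑' y, S x y * v y ≤ γ * v x + b * (if x.1 = 0 then 1 else 0)

/-- The total variation norm `‖x‖ = ∑ |x(k, i)|`. -/
noncomputable def tvNorm {d : ℕ} (x : BlockState d → ℝ) : ℝ :=
  ∑' y, |x y|

/-! ### Sums over the block state space -/

/-- The action `S f` of a matrix on a column vector. -/
noncomputable def rowApply {d : ℕ} (S : Matrix (BlockState d) (BlockState d) ℝ)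
    (f : BlockState d → ℝ) (x : BlockState d) : ℝ :=
  ∑' y, S x y * f y

theorem summable_mul_of_bounded {α : Type*} {a f : α → ℝ} {C : ℝ} (ha : ∀ x, 0 ≤ a x)
    (hs : Summable a) (hf : ∀ x, |f x| ≤ C) : Summable fun x => a x * f x := by
  refine Summable.of_norm_bounded (hs.mul_right C) fun x => ?_
  rw [Real.norm_eq_abs, abs_mul, abs_of_nonneg (ha x)]
  exact mul_le_mul_of_nonneg_left (hf x) (ha x)

theorem abs_tsum_mul_le {α : Type*} {a f : α → ℝ} {C : ℝ} (ha : ∀ x, 0 ≤ a x)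
    (hs : HasSum a 1) (hf : ∀ x, |f x| ≤ C) : |∑' x, a x * f x| ≤ C := by
  have hsum := summable_mul_of_bounded ha hs.summable hf
  have h1 : (∑' x, a x * C) = C := by rw [tsum_mul_right, hs.tsum_eq, one_mul]
  rw [abs_le]
  constructor
  · rw [← h1, ← tsum_neg]
    refine Summable.tsum_le_tsum (fun x => ?_) (hs.summable.mul_right C).neg hsum
    rw [← mul_neg]
    exact mul_le_mul_of_nonneg_left (abs_le.1 (hf x)).1 (ha x)
  · rw [← h1]
    exact Summable.tsum_le_tsum
      (fun x => mul_le_mul_of_nonneg_left (abs_le.1 (hf x)).2 (ha x)) hsum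
      (hs.summable.mul_right C)

theorem summable_phase {d : ℕ} {f : BlockState d → ℝ} (hf : Summable f) (j : Fin d) :
    Summable fun l : ℕ => f (l, j) :=
  hf.comp_injective fun _ _ h => (Prod.ext_iff.1 h).1

theorem hasSum_of_phases {d : ℕ} {f : BlockState d → ℝ} {s : Fin d → ℝ}
    (hf : ∀ j, HasSum (fun l : ℕ => f (l, j)) (s j)) : HasSum f (∑ j, s j) := by
  classical
  have key : ∀ j, HasSum (fun y : BlockState d => if y.2 = j then f y else 0) (s j) := by
    intro j
    have hi : Function.Injective fun l : ℕ => ((l, j) : BlockState d) :=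
      fun _ _ h => (Prod.ext_iff.1 h).1
    rw [← hi.hasSum_iff]
    · simpa [Function.comp_def] using hf j
    · rintro ⟨l, i⟩ hl
      rw [if_neg]
      rintro rfl
      exact hl ⟨l, rfl⟩
  simpa using hasSum_sum fun j (_ : j ∈ Finset.univ) => key j

theorem tsum_eq_sum_phases {d : ℕ} {f : BlockState d → ℝ} (hf : Summable f) :
    ∑' y, f y = ∑ j, ∑' l : ℕ, f (l, j) :=
  (hasSum_of_phases fun j => (summable_phase hf j).hasSum).tsum_eq

/-! ### Tail domination -/

/-- If the tails of `a` are bounded by those of `b`, then `∑ a g ≤ ∑ b g` for every nonnegative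
nondecreasing `g`. -/
theorem tsum_mul_le_of_tails_le {a b g : ℕ → ℝ} (ha : ∀ l, 0 ≤ a l) (hb : ∀ l, 0 ≤ b l)
    (has : Summable a) (hbs : Summable b)
    (hab : ∀ l, ∑' m, a (l + m) ≤ ∑' m, b (l + m))
    (hg0 : ∀ l, 0 ≤ g l) (hg : Monotone g) (hbg : Summable fun l => b l * g l) :
    (Summable fun l => a l * g l) ∧ ∑' l, a l * g l ≤ ∑' l, b l * g l := by
  have tail_succ : ∀ {c : ℕ → ℝ}, Summable c → ∀ N,
      ∑' m, c (N + m) = c N + ∑' m, c (N + 1 + m) := by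
    intro c hc N
    have : Summable fun m => c (N + m) := hc.comp_injective (add_right_injective N)
    rw [this.tsum_eq_zero_add]
    simp [add_assoc, add_comm 1]
  have abel : ∀ N, ∑ l ∈ Finset.range N, a l * g l + (∑' m, a (N + m)) * g N ≤
      ∑ l ∈ Finset.range N, b l * g l + (∑' m, b (N + m)) * g N := by
    intro N
    induction N with
    | zero => simpa using mul_le_mul_of_nonneg_right (hab 0) (hg0 0)
    | succ N ih =>
      rw [tail_succ has N, tail_succ hbs N] at ih
      rw [Finset.sum_range_succ, Finset.sum_range_succ]
      have := mul_le_mul_of_nonneg_right (hab (N + 1)) (sub_nonneg.2 (hg N.le_succ))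
      simp only [Nat.succ_eq_add_one] at this
      linarith
  have tail_le : ∀ N, ∑ l ∈ Finset.range N, b l * g l + (∑' m, b (N + m)) * g N ≤
      ∑' l, b l * g l := by
    intro N
    rw [← hbg.sum_add_tsum_nat_add N, ← tsum_mul_right]
    simp only [add_comm N]
    refine add_le_add le_rfl (Summable.tsum_le_tsum (fun m => ?_) ?_ ?_)
    · exact mul_le_mul_of_nonneg_left (hg (by omega)) (hb _)
    · exact (hbs.comp_injective (add_left_injective N)).mul_right _
    · exact hbg.comp_injective (add_left_injective N)
  have part : ∀ N, ∑ l ∈ Finset.range N, a l * g l ≤ ∑' l, b l * g l := fun N => by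
    have h0 : 0 ≤ (∑' m, a (N + m)) * g N := mul_nonneg (tsum_nonneg fun _ => ha _) (hg0 N)
    linarith [abel N, tail_le N]
  have hnn : ∀ l, 0 ≤ a l * g l := fun l => mul_nonneg (ha l) (hg0 l)
  exact ⟨summable_of_sum_range_le hnn part, Real.tsum_le_of_sum_range_le hnn part⟩

theorem IsBlockIncreasing.monotone {d : ℕ} {f : BlockState d → ℝ} (hf : IsBlockIncreasing f)
    (j : Fin d) : Monotone fun l : ℕ => f (l, j) :=
  monotone_nat_of_le_succ fun l => hf l j

theorem tsum_mul_le_of_blockTails_le {d : ℕ} {a b g : BlockState d → ℝ}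
    (ha : ∀ x, 0 ≤ a x) (hb : ∀ x, 0 ≤ b x) (has : Summable a) (hbs : Summable b)
    (hab : ∀ l j, ∑' m : ℕ, a (l + m, j) ≤ ∑' m : ℕ, b (l + m, j))
    (hg0 : ∀ x, 0 ≤ g x) (hg : IsBlockIncreasing g) (hbg : Summable fun x => b x * g x) :
    (Summable fun x => a x * g x) ∧ ∑' x, a x * g x ≤ ∑' x, b x * g x := by
  have key := fun j : Fin d => tsum_mul_le_of_tails_le (fun l => ha (l, j)) (fun l => hb (l, j))
    (summable_phase has j) (summable_phase hbs j) (fun l => hab l j) (fun l => hg0 (l, j))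
    (hg.monotone j) (summable_phase hbg j)
  have hs := hasSum_of_phases (f := fun x => a x * g x) fun j => (key j).1.hasSum
  refine ⟨hs.summable, ?_⟩
  rw [hs.tsum_eq, tsum_eq_sum_phases hbg]
  exact Finset.sum_le_sum fun j _ => (key j).2

/-- For vectors of equal total mass, bounded block-increasing test vectors of either sign are
allowed. -/
theorem tsum_mul_le_of_blockTails_le_of_bounded {d : ℕ} {a b g : BlockState d → ℝ} {C : ℝ}
    (ha : ∀ x, 0 ≤ a x) (hb : ∀ x, 0 ≤ b x) (has : HasSum a 1) (hbs : HasSum b 1)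
    (hab : ∀ l j, ∑' m : ℕ, a (l + m, j) ≤ ∑' m : ℕ, b (l + m, j))
    (hgC : ∀ x, |g x| ≤ C) (hg : IsBlockIncreasing g) :
    ∑' x, a x * g x ≤ ∑' x, b x * g x := by
  have sa := summable_mul_of_bounded ha has.summable hgC
  have sb := summable_mul_of_bounded hb hbs.summable hgC
  have ea := (sa.hasSum.add (has.mul_right C))
  have eb := (sb.hasSum.add (hbs.mul_right C))
  simp only [← mul_add] at ea eb
  have := (tsum_mul_le_of_blockTails_le (g := fun x => g x + C) ha hb has.summable hbs.summable
    hab (fun x => by linarith [(abs_le.1 (hgC x)).1]) (fun k i => by simpa using hg k i)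
    eb.summable).2
  rw [ea.tsum_eq, eb.tsum_eq] at this
  linarith

/-! ### Stationary vectors -/

theorem summable_mul_kernel {α β : Type*} {a : α → ℝ} {S : α → β → ℝ} (ha : ∀ x, 0 ≤ a x)
    (has : Summable a) (hS : ∀ x y, 0 ≤ S x y) (hS1 : ∀ x, HasSum (S x) 1) :
    Summable fun z : α × β => a z.1 * S z.1 z.2 := by
  have hnn : 0 ≤ fun z : α × β => a z.1 * S z.1 z.2 := fun z => mul_nonneg (ha z.1) (hS z.1 z.2)
  refine (summable_prod_of_nonneg hnn).2 ⟨fun x => (hS1 x).summable.mul_left (a x), ?_⟩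
  simpa only [tsum_mul_left, fun x => (hS1 x).tsum_eq, mul_one] using has

theorem IsStationaryVector.tsum_rowApply {d : ℕ} {S : Matrix (BlockState d) (BlockState d) ℝ}
    {p f : BlockState d → ℝ} {C : ℝ} (hS : IsStochastic S) (hp : IsStationaryVector S p)
    (hf : ∀ x, |f x| ≤ C) : ∑' x, p x * rowApply S f x = ∑' x, p x * f x := by
  have hjf : Summable (Function.uncurry fun x y => p x * S x y * f y) :=
    summable_mul_of_bounded (f := fun z : BlockState d × BlockState d => f z.2)
      (fun z => mul_nonneg (hp.1 z.1) (hS.1 z.1 z.2))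
      (summable_mul_kernel hp.1 hp.2.1.summable hS.1 hS.2) fun z => hf z.2
  calc ∑' x, p x * rowApply S f x = ∑' x, ∑' y, p x * S x y * f y := by
        simp only [rowApply, ← tsum_mul_left, mul_assoc]
    _ = ∑' y, ∑' x, p x * S x y * f y := hjf.tsum_comm.symm
    _ = ∑' y, p y * f y :=
        tsum_congr fun y => by rw [tsum_mul_right, (hp.2.2 y).tsum_eq]

theorem abs_rowApply_le {d : ℕ} {S : Matrix (BlockState d) (BlockState d) ℝ}
    {f : BlockState d → ℝ} {C : ℝ} (hS : IsStochastic S) (hf : ∀ x, |f x| ≤ C)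
    (x : BlockState d) : |rowApply S f x| ≤ C :=
  abs_tsum_mul_le (hS.1 x) (hS.2 x) hf

theorem rowApply_mono {d : ℕ} {S : Matrix (BlockState d) (BlockState d) ℝ}
    {f g : BlockState d → ℝ} {x : BlockState d} (hS : IsStochastic S)
    (hf : Summable fun y => S x y * f y) (hg : Summable fun y => S x y * g y)
    (hfg : ∀ y, f y ≤ g y) : rowApply S f x ≤ rowApply S g x :=
  Summable.tsum_le_tsum (fun y => mul_le_mul_of_nonneg_left (hfg y) (hS.1 x y)) hf hg

/-- A drift condition bounds the mean of the Lyapunov function under every stationary vector. -/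
theorem IsStationaryVector.tsum_le_of_drift {d : ℕ}
    {S : Matrix (BlockState d) (BlockState d) ℝ} {p v : BlockState d → ℝ} {γ b : ℝ}
    (hS : IsStochastic S) (hp : IsStationaryVector S p) (hγ0 : 0 < γ) (hγ1 : γ < 1) (hb : 0 < b)
    (hv : ∀ x, 0 ≤ v x) (hSv : ∀ x, Summable fun y => S x y * v y)
    (hdrift : ∀ x, rowApply S v x ≤ γ * v x + b) :
    (Summable fun x => p x * v x) ∧ ∑' x, p x * v x ≤ b / (1 - γ) := by
  have hbound : ∀ s : Finset (BlockState d), ∑ x ∈ s, p x * v x ≤ b / (1 - γ) := by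
    intro s
    obtain ⟨N, hN⟩ : ∃ N : ℝ, ∀ x ∈ s, v x + b ≤ N := by
      obtain ⟨N, hN⟩ := (s.image fun x => v x + b).exists_le
      exact ⟨N, fun x hx => hN _ (Finset.mem_image_of_mem _ hx)⟩
    set M := max N b
    have hM0 : 0 ≤ M := hb.le.trans (le_max_right _ _)
    set w : BlockState d → ℝ := fun x => min (v x) M with hw
    have hwb : ∀ x, |w x| ≤ M := fun x => by
      rw [abs_of_nonneg (le_min (hv x) hM0)]; exact min_le_right _ _
    set r : BlockState d → ℝ := fun x => min (γ * v x + b) M with hr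
    have hrb : ∀ x, |r x| ≤ M := fun x => by
      rw [abs_of_nonneg (le_min (add_nonneg (mul_nonneg hγ0.le (hv x)) hb.le) hM0)]
      exact min_le_right _ _
    have hSw : ∀ x, rowApply S w x ≤ r x := by
      intro x
      have sw := summable_mul_of_bounded (hS.1 x) (hS.2 x).summable hwb
      refine le_min ?_ (abs_le.1 (abs_rowApply_le hS hwb x)).2
      exact (rowApply_mono hS sw (hSv x) fun y => min_le_left _ _).trans (hdrift x)
    have pw := summable_mul_of_bounded hp.1 hp.2.1.summable hwb
    have pr := summable_mul_of_bounded hp.1 hp.2.1.summable hrb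
    have pSw := summable_mul_of_bounded hp.1 hp.2.1.summable (abs_rowApply_le hS hwb)
    have h1 : ∑' x, p x * w x ≤ ∑' x, p x * r x := by
      rw [← hp.tsum_rowApply hS hwb]
      exact Summable.tsum_le_tsum (fun x => mul_le_mul_of_nonneg_left (hSw x) (hp.1 x)) pSw pr
    have hsum : HasSum (fun x => p x * (w x - r x + b))
        (∑' x, p x * w x - ∑' x, p x * r x + 1 * b) := by
      simpa only [mul_add, mul_sub] using (pw.hasSum.sub pr.hasSum).add (hp.2.1.mul_right b)
    have hnn : ∀ x, 0 ≤ w x - r x + b := by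
      intro x
      have h2 : r x ≤ w x + b := by
        have : γ * v x ≤ v x := mul_le_of_le_one_left (hv x) hγ1.le
        rcases min_cases (v x) M with ⟨h, _⟩ | ⟨h, _⟩
        · simp only [hw, hr, h]; exact (min_le_left _ _).trans (by linarith)
        · simp only [hw, hr, h]; exact (min_le_right _ _).trans (by linarith)
      linarith
    have h3 : ∑ x ∈ s, p x * (w x - r x + b) ≤ b := by
      have := sum_le_hasSum s (fun x _ => mul_nonneg (hp.1 x) (hnn x)) hsum
      linarith
    have h4 : ∑ x ∈ s, p x * (w x - r x + b) = (1 - γ) * ∑ x ∈ s, p x * v x := by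
      rw [Finset.mul_sum]
      refine Finset.sum_congr rfl fun x hx => ?_
      have h5 := (hN x hx).trans (le_max_left N b)
      have : γ * v x ≤ v x := mul_le_of_le_one_left (hv x) hγ1.le
      simp only [hw, hr]
      rw [min_eq_left (by linarith), min_eq_left (by linarith)]
      ring
    rw [le_div_iff₀ (by linarith), mul_comm]
    linarith
  have hnn : ∀ x, 0 ≤ p x * v x := fun x => mul_nonneg (hp.1 x) (hv x)
  exact ⟨summable_of_sum_le hnn hbound, Real.tsum_le_of_sum_le hnn hbound⟩

/-! ### Truncation -/

theorem hasSum_truncate {a f : ℕ → ℝ} {C : ℝ} (ha : ∀ l, 0 ≤ a l) (has : Summable a)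
    (hf : ∀ l, |f l| ≤ C) (n : ℕ) :
    HasSum (fun l => (if l < n then a l else if l = n then ∑' m, a (n + m) else 0) * f l)
      (∑' l, a l * f (min l n)) := by
  have hs := summable_mul_of_bounded (f := fun l => f (min l n)) ha has fun l => hf _
  have h1 := hasSum_sum_of_ne_finset_zero (L := .unconditional ℕ) (s := Finset.range (n + 1)) (f := fun l =>
    (if l < n then a l else if l = n then ∑' m, a (n + m) else 0) * f l) fun l hl => by
      rw [Finset.mem_range] at hl
      rw [if_neg (by omega), if_neg (by omega), zero_mul]
  convert h1 using 1
  rw [← hs.sum_add_tsum_nat_add n, Finset.sum_range_succ]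
  congr 1
  · refine Finset.sum_congr rfl fun l hl => ?_
    rw [Finset.mem_range] at hl
    rw [if_pos hl, min_eq_left hl.le]
  · simp [tsum_mul_right, add_comm n]

theorem hasSum_lastColumnTruncation {d : ℕ} {P : Matrix (BlockState d) (BlockState d) ℝ}
    {f : BlockState d → ℝ} {C : ℝ} (hP : IsStochastic P) (hf : ∀ x, |f x| ≤ C) (n : ℕ)
    (x : BlockState d) :
    HasSum (fun y => lastColumnTruncation n P x y * f y)
      (rowApply P (fun y => f (min y.1 n, y.2)) x) := by
  have hs := summable_mul_of_bounded (f := fun y : BlockState d => f (min y.1 n, y.2)) (hP.1 x)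
    (hP.2 x).summable fun y => hf _
  rw [rowApply, tsum_eq_sum_phases hs]
  exact hasSum_of_phases fun j => hasSum_truncate (fun l => hP.1 x (l, j))
    (summable_phase (hP.2 x).summable j) (fun l => hf (l, j)) n

theorem rowApply_lastColumnTruncation {d : ℕ} {P : Matrix (BlockState d) (BlockState d) ℝ}
    {f : BlockState d → ℝ} {C : ℝ} (hP : IsStochastic P) (hf : ∀ x, |f x| ≤ C) (n : ℕ)
    (x : BlockState d) :
    rowApply (lastColumnTruncation n P) f x = rowApply P (fun y => f (min y.1 n, y.2)) x :=
  (hasSum_lastColumnTruncation hP hf n x).tsum_eq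

theorem IsStochastic.lastColumnTruncation {d : ℕ}
    {P : Matrix (BlockState d) (BlockState d) ℝ} (hP : IsStochastic P) (n : ℕ) :
    IsStochastic (lastColumnTruncation n P) := by
  refine ⟨fun x y => ?_, fun x => ?_⟩
  · unfold _root_.lastColumnTruncation
    split_ifs
    · exact hP.1 x y
    · exact tsum_nonneg fun _ => hP.1 _ _
    · exact le_rfl
  · simpa [rowApply, (hP.2 x).tsum_eq] using
      hasSum_lastColumnTruncation (f := fun _ => (1 : ℝ)) (C := 1) hP (by simp) n x

theorem blockTail_eq_rowApply {d : ℕ} (S : Matrix (BlockState d) (BlockState d) ℝ)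
    (x : BlockState d) (l : ℕ) (j : Fin d) :
    blockTail S x l j = rowApply S (fun y => if l ≤ y.1 ∧ y.2 = j then 1 else 0) x := by
  have hi : Function.Injective fun m : ℕ => ((l + m, j) : BlockState d) := fun a b h => by
    simpa using h
  rw [rowApply, ← hi.tsum_eq]
  · simp [blockTail]
  · rintro ⟨k, i⟩ hk
    simp only [Function.mem_support, ne_eq, mul_ite, mul_one, mul_zero, ite_eq_right_iff,
      Classical.not_imp] at hk
    obtain ⟨⟨hk1, rfl⟩, -⟩ := hk
    exact ⟨k - l, by simp; omega⟩

theorem BlockwiseDominated.lastColumnTruncation {d : ℕ}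
    {P Q : Matrix (BlockState d) (BlockState d) ℝ} (hP : IsStochastic P)
    (h : BlockwiseDominated P Q) (n : ℕ) : BlockwiseDominated (lastColumnTruncation n P) Q := by
  intro x l j
  have hb : ∀ y : BlockState d, |if l ≤ y.1 ∧ y.2 = j then (1 : ℝ) else 0| ≤ 1 := fun y => by
    split_ifs <;> simp
  refine le_trans ?_ (h x l j)
  rw [blockTail_eq_rowApply, rowApply_lastColumnTruncation hP hb, blockTail_eq_rowApply]
  refine rowApply_mono hP (summable_mul_of_bounded (hP.1 x) (hP.2 x).summable fun y => hb _)
    (summable_mul_of_bounded (hP.1 x) (hP.2 x).summable hb) fun y => ?_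
  split_ifs with h1 h2
  · exact le_rfl
  · exact absurd ⟨h1.1.trans (min_le_left _ _), h1.2⟩ h2
  · exact zero_le_one
  · exact le_rfl

/-! ### Phase process -/

theorem IsStochastic.sum_blockTail_zero {d : ℕ} {S : Matrix (BlockState d) (BlockState d) ℝ}
    (hS : IsStochastic S) (x : BlockState d) : ∑ j, blockTail S x 0 j = 1 := by
  rw [← (hS.2 x).tsum_eq, tsum_eq_sum_phases (hS.2 x).summable]
  simp [blockTail]

/-- A stochastic matrix dominated by a block-monotone one has the same phase transitions,
independently of the level. -/
theorem IsBlockMonotone.blockTail_zero_eq {d : ℕ}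
    {Q Pt : Matrix (BlockState d) (BlockState d) ℝ} (hPt : IsBlockMonotone Pt)
    (hQ : IsStochastic Q) (hdom : BlockwiseDominated Q Pt) (x : BlockState d) (j : Fin d) :
    blockTail Q x 0 j = blockTail Pt (0, x.2) 0 j := by
  have eq_of_le : ∀ {f g : Fin d → ℝ}, (∀ j, f j ≤ g j) → ∑ j, f j = ∑ j, g j →
      ∀ j, f j = g j := fun hle hs j =>
    (Finset.sum_eq_sum_iff_of_le fun j _ => hle j).1 hs j (Finset.mem_univ j)
  obtain ⟨k, i⟩ := x
  have h1 := eq_of_le (hdom (k, i) 0)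
    (by rw [hQ.sum_blockTail_zero, hPt.1.sum_blockTail_zero]) j
  rw [h1]
  clear h1
  induction k with
  | zero => rfl
  | succ k ih =>
    rw [← ih]
    exact (eq_of_le (fun j => hPt.2 k 0 i j)
      (by rw [hPt.1.sum_blockTail_zero, hPt.1.sum_blockTail_zero]) j).symm

theorem IsStationaryVector.phase_stationary {d : ℕ}
    {Q Pt : Matrix (BlockState d) (BlockState d) ℝ} {p : BlockState d → ℝ}
    (hPt : IsBlockMonotone Pt) (hQ : IsStochastic Q) (hdom : BlockwiseDominated Q Pt)
    (hp : IsStationaryVector Q p) (j : Fin d) :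
    ∑ i, (∑' l : ℕ, p (l, i)) * blockTail Pt (0, i) 0 j = ∑' l : ℕ, p (l, j) := by
  have hb : ∀ y : BlockState d, |if 0 ≤ y.1 ∧ y.2 = j then (1 : ℝ) else 0| ≤ 1 := fun y => by
    split_ifs <;> simp
  have h := hp.tsum_rowApply hQ hb
  have hs := summable_mul_of_bounded hp.1 hp.2.1.summable (abs_rowApply_le hQ hb)
  have hs' := summable_mul_of_bounded hp.1 hp.2.1.summable hb
  rw [tsum_eq_sum_phases hs, tsum_eq_sum_phases hs'] at h
  simp only [← blockTail_eq_rowApply, hPt.blockTail_zero_eq hQ hdom, tsum_mul_right] at h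
  rw [h, Finset.sum_eq_single j (fun i _ hi => by simp [hi]) (by simp)]
  simp

theorem IsIrreducible.phase_closed {d : ℕ} {Pt : Matrix (BlockState d) (BlockState d) ℝ}
    (hPt : IsBlockMonotone Pt) (hirr : Pt.IsIrreducible) {A : Set (Fin d)}
    (hA : ∀ i ∈ A, ∀ j, 0 < blockTail Pt (0, i) 0 j → j ∈ A) {i : Fin d} (hi : i ∈ A)
    (j : Fin d) : j ∈ A := by
  let : Quiver (BlockState d) := Pt.toQuiver
  obtain ⟨path, -⟩ := hirr.connected (0, i) (0, j)
  suffices ∀ y : BlockState d, Quiver.Path ((0, i) : BlockState d) y → y.2 ∈ A from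
    this _ path
  intro y path
  induction path with
  | nil => exact hi
  | @cons y z _ e ih =>
    refine hA _ ih _ ?_
    rw [← hPt.blockTail_zero_eq hPt.1 (fun _ _ _ => le_rfl) y z.2]
    refine (e.down : 0 < Pt y z).trans_le ?_
    have := (summable_phase (hPt.1.2 y).summable z.2).le_tsum z.1 fun m _ => hPt.1.1 _ _
    simpa [blockTail] using this

/-- A signed invariant vector of total mass zero for an irreducible phase process vanishes. -/
theorem phase_invariant_eq_zero {d : ℕ} {Pt : Matrix (BlockState d) (BlockState d) ℝ}
    (hPt : IsBlockMonotone Pt) (hirr : Pt.IsIrreducible) {u : Fin d → ℝ}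
    (hu : ∀ j, ∑ i, u i * blockTail Pt (0, i) 0 j = u j) (hu0 : ∑ i, u i = 0) (j : Fin d) :
    u j = 0 := by
  have hΨ : ∀ i j, 0 ≤ blockTail Pt (0, i) 0 j := fun i j => tsum_nonneg fun _ => hPt.1.1 _ _
  have hle : ∀ j, max (u j) 0 ≤ ∑ i, max (u i) 0 * blockTail Pt (0, i) 0 j := by
    intro j
    refine max_le ?_ (Finset.sum_nonneg fun i _ => mul_nonneg (le_max_right _ _) (hΨ i j))
    rw [← hu j]
    exact Finset.sum_le_sum fun i _ => mul_le_mul_of_nonneg_right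
      (le_max_left _ _) (hΨ i j)
  have hsum : ∑ j, max (u j) 0 = ∑ j, ∑ i, max (u i) 0 * blockTail Pt (0, i) 0 j := by
    rw [Finset.sum_comm]
    simp [← Finset.mul_sum, hPt.1.sum_blockTail_zero]
  have heq := (Finset.sum_eq_sum_iff_of_le fun j _ => hle j).1 hsum
  have hclosed : ∀ i ∈ {i | 0 < u i}, ∀ j, 0 < blockTail Pt (0, i) 0 j → j ∈ {i | 0 < u i} := by
    intro i hi j hij
    have h1 : 0 < max (u j) 0 := by
      rw [heq j (Finset.mem_univ j)]
      refine (mul_pos (lt_max_of_lt_left (c := 0) hi) hij).trans_le ?_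
      exact Finset.single_le_sum (f := fun i => max (u i) 0 * blockTail Pt (0, i) 0 j)
        (fun i _ => mul_nonneg (le_max_right _ _) (hΨ i j)) (Finset.mem_univ i)
    simpa using h1
  have hnonpos : ∀ i, u i ≤ 0 := by
    intro i
    by_contra! hi
    have hall := IsIrreducible.phase_closed hPt hirr hclosed hi
    exact (Finset.sum_pos (fun j _ => hall j) ⟨i, Finset.mem_univ i⟩).ne' hu0
  exact (Finset.sum_eq_zero_iff_of_nonpos fun i _ => hnonpos i).1 hu0 j (Finset.mem_univ j)

theorem phase_marginal_unique {d : ℕ} {Q Q' Pt : Matrix (BlockState d) (BlockState d) ℝ}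
    {p p' : BlockState d → ℝ} (hPt : IsBlockMonotone Pt) (hirr : Pt.IsIrreducible)
    (hQ : IsStochastic Q) (hdom : BlockwiseDominated Q Pt) (hp : IsStationaryVector Q p)
    (hQ' : IsStochastic Q') (hdom' : BlockwiseDominated Q' Pt) (hp' : IsStationaryVector Q' p')
    (j : Fin d) : ∑' l : ℕ, p (l, j) = ∑' l : ℕ, p' (l, j) := by
  refine sub_eq_zero.1 (phase_invariant_eq_zero hPt hirr
    (u := fun j => ∑' l : ℕ, p (l, j) - ∑' l : ℕ, p' (l, j)) (fun j => ?_) ?_ j)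
  · simp only [sub_mul, Finset.sum_sub_distrib]
    rw [hp.phase_stationary hPt hQ hdom, hp'.phase_stationary hPt hQ' hdom']
  · rw [Finset.sum_sub_distrib, ← tsum_eq_sum_phases hp.2.1.summable,
      ← tsum_eq_sum_phases hp'.2.1.summable, hp.2.1.tsum_eq, hp'.2.1.tsum_eq, sub_self]

/-! ### Block-increasing envelopes -/

theorem IsBlockMonotone.rowApply_blockIncreasing {d : ℕ}
    {Pt : Matrix (BlockState d) (BlockState d) ℝ} {g : BlockState d → ℝ} {C : ℝ}
    (hPt : IsBlockMonotone Pt) (hgC : ∀ x, |g x| ≤ C) (hg : IsBlockIncreasing g) :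
    IsBlockIncreasing (rowApply Pt g) := fun k i =>
  tsum_mul_le_of_blockTails_le_of_bounded (hPt.1.1 _) (hPt.1.1 _) (hPt.1.2 _) (hPt.1.2 _)
    (fun l j => hPt.2 k l i j) hgC hg

/-- If `F ≤ U` with `U` block-increasing, then `Q F` has a block-increasing majorant which agrees
with `Q F` on level `0` and with `P̃ U` on the other levels. -/
theorem upper_envelope_step {d : ℕ} {Q Pt : Matrix (BlockState d) (BlockState d) ℝ}
    {F U : BlockState d → ℝ} {C : ℝ} (hPt : IsBlockMonotone Pt) (hQ : IsStochastic Q)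
    (hdom : BlockwiseDominated Q Pt) (hF : ∀ x, |F x| ≤ C) (hU : ∀ x, |U x| ≤ C)
    (hUi : IsBlockIncreasing U) (hFU : ∀ x, F x ≤ U x) :
    ∃ V : BlockState d → ℝ, (∀ x, |V x| ≤ C) ∧ IsBlockIncreasing V ∧
      (∀ x, rowApply Q F x ≤ V x) ∧ (∀ x, x.1 = 0 → V x = rowApply Q F x) ∧
      ∀ x, x.1 ≠ 0 → V x = rowApply Pt U x := by
  have hle : ∀ x, rowApply Q F x ≤ rowApply Pt U x := fun x =>
    (rowApply_mono hQ (summable_mul_of_bounded (hQ.1 x) (hQ.2 x).summable hF)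
      (summable_mul_of_bounded (hQ.1 x) (hQ.2 x).summable hU) hFU).trans
    (tsum_mul_le_of_blockTails_le_of_bounded (hQ.1 _) (hPt.1.1 _) (hQ.2 _) (hPt.1.2 _)
      (hdom x) hU hUi)
  have hmono := hPt.rowApply_blockIncreasing hU hUi
  refine ⟨fun x => if x.1 = 0 then rowApply Q F x else rowApply Pt U x, fun x => ?_,
    fun k i => ?_, fun x => ?_, fun x hx => if_pos hx, fun x hx => if_neg hx⟩
  · dsimp only
    split_ifs
    · exact abs_rowApply_le hQ hF x
    · exact abs_rowApply_le hPt.1 hU x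
  · dsimp only
    rw [if_neg k.succ_ne_zero]
    split_ifs
    · exact (hle _).trans (hmono k i)
    · exact hmono k i
  · dsimp only
    split_ifs
    · exact le_rfl
    · exact hle x

theorem rowApply_neg {d : ℕ} (S : Matrix (BlockState d) (BlockState d) ℝ)
    (f : BlockState d → ℝ) (x : BlockState d) :
    rowApply S (fun y => -f y) x = -rowApply S f x := by
  simp only [rowApply, mul_neg, tsum_neg]

theorem abs_iterate_rowApply_le {d : ℕ} {Q : Matrix (BlockState d) (BlockState d) ℝ}
    {f : BlockState d → ℝ} {C : ℝ} (hQ : IsStochastic Q) (hf : ∀ x, |f x| ≤ C) (m : ℕ) :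
    ∀ x, |(rowApply Q)^[m] f x| ≤ C := by
  induction m with
  | zero => exact hf
  | succ m ih => rw [Function.iterate_succ_apply']; exact abs_rowApply_le hQ ih

theorem exists_envelopes {d : ℕ} {Q Pt : Matrix (BlockState d) (BlockState d) ℝ}
    {f v : BlockState d → ℝ} {γ b : ℝ} (hPt : IsBlockMonotone Pt) (hQ : IsStochastic Q)
    (hdom : BlockwiseDominated Q Pt) (hv1 : ∀ x, 1 ≤ v x) (hγ0 : 0 < γ)
    (hdrift : GeometricDrift Pt v γ b) (hf : ∀ x, |f x| ≤ 1) (m : ℕ) :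
    ∃ U L : BlockState d → ℝ, (∀ x, |U x| ≤ 1) ∧ (∀ x, |L x| ≤ 1) ∧ IsBlockIncreasing U ∧
      IsBlockIncreasing (fun x => -L x) ∧ (∀ x, (rowApply Q)^[m] f x ≤ U x) ∧
      (∀ x, L x ≤ (rowApply Q)^[m] f x) ∧ ∀ x, U x - L x ≤ 2 * γ ^ m * v x := by
  induction m with
  | zero =>
    refine ⟨fun _ => 1, fun _ => -1, by simp, by simp, fun _ _ => le_rfl, fun _ _ => le_rfl,
      fun x => (abs_le.1 (hf x)).2, fun x => (abs_le.1 (hf x)).1, fun x => ?_⟩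
    have := hv1 x
    norm_num
    linarith
  | succ m ih =>
    obtain ⟨U, L, hU, hL, hUi, hLi, hFU, hLF, hUL⟩ := ih
    have hF := abs_iterate_rowApply_le hQ hf m
    have hLn : ∀ x, |-L x| ≤ 1 := fun x => by rw [abs_neg]; exact hL x
    obtain ⟨V, hV, hVi, hFV, hV0, hV1⟩ := upper_envelope_step hPt hQ hdom hF hU hUi hFU
    obtain ⟨W, hW, hWi, hFW, hW0, hW1⟩ := upper_envelope_step (F := fun x =>
      -(rowApply Q)^[m] f x) hPt hQ hdom (fun x => by rw [abs_neg]; exact hF x) hLn hLi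
      fun x => neg_le_neg (hLF x)
    simp only [rowApply_neg] at hFW hW0 hW1
    rw [Function.iterate_succ_apply']
    refine ⟨V, fun x => -W x, hV, fun x => by rw [abs_neg]; exact hW x, hVi,
      fun k i => by simpa using hWi k i, hFV, fun x => by linarith [hFW x], fun x => ?_⟩
    dsimp only
    by_cases hx : x.1 = 0
    · rw [hV0 x hx, hW0 x hx]
      have : 0 ≤ 2 * γ ^ (m + 1) * v x :=
        mul_nonneg (by positivity) (zero_le_one.trans (hv1 x))
      linarith
    · have hsU := summable_mul_of_bounded (hPt.1.1 x) (hPt.1.2 x).summable hU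
      have hsL := summable_mul_of_bounded (hPt.1.1 x) (hPt.1.2 x).summable hL
      obtain ⟨hsv, hdr⟩ := hdrift x
      rw [if_neg hx, mul_zero, add_zero] at hdr
      have h1 : rowApply Pt U x - rowApply Pt L x ≤
          2 * γ ^ m * ∑' y, Pt x y * v y := by
        rw [rowApply, rowApply, ← hsU.tsum_sub hsL, ← tsum_mul_left]
        refine Summable.tsum_le_tsum (fun y => ?_) (hsU.sub hsL) (hsv.mul_left _)
        rw [← mul_sub, mul_left_comm]
        exact mul_le_mul_of_nonneg_left (hUL y) (hPt.1.1 x y)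
      have h2 := mul_le_mul_of_nonneg_left hdr (by positivity : 0 ≤ 2 * γ ^ m)
      rw [hV1 x hx, hW1 x hx]
      calc rowApply Pt U x - - -rowApply Pt L x = rowApply Pt U x - rowApply Pt L x := by ring
        _ ≤ 2 * γ ^ m * (γ * v x) := h1.trans h2
        _ = 2 * γ ^ (m + 1) * v x := by ring

/-- Contraction: the iterates `Q^m f` become independent of the level at a geometric rate. -/
theorem abs_iterate_rowApply_sub_le {d : ℕ} {Q Pt : Matrix (BlockState d) (BlockState d) ℝ}
    {f v : BlockState d → ℝ} {γ b : ℝ} (hPt : IsBlockMonotone Pt) (hQ : IsStochastic Q)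
    (hdom : BlockwiseDominated Q Pt) (hv1 : ∀ x, 1 ≤ v x) (hγ0 : 0 < γ)
    (hdrift : GeometricDrift Pt v γ b) (hf : ∀ x, |f x| ≤ 1) (m : ℕ) (x : BlockState d) :
    |(rowApply Q)^[m] f x - (rowApply Q)^[m] f (0, x.2)| ≤ 2 * γ ^ m * v x := by
  obtain ⟨U, L, -, -, hUi, hLi, hFU, hLF, hUL⟩ :=
    exists_envelopes hPt hQ hdom hv1 hγ0 hdrift hf m
  have h1 := hUi.monotone x.2 (Nat.zero_le x.1)
  have h2 := hLi.monotone x.2 (Nat.zero_le x.1)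
  simp only [Prod.mk.eta] at h1 h2
  rw [abs_le]
  constructor <;> linarith [hFU x, hFU (0, x.2), hLF x, hLF (0, x.2), hUL x]

theorem abs_tsum_mul_sub_level_zero_le {d : ℕ} {p v F : BlockState d → ℝ} {ε : ℝ}
    (hp : ∀ x, 0 ≤ p x) (hs : HasSum p 1) (hF : ∀ x, |F x| ≤ 1)
    (hpv : Summable fun x => p x * v x) (h : ∀ x, |F x - F (0, x.2)| ≤ ε * v x) :
    |∑' x, p x * F x - ∑ j, (∑' l : ℕ, p (l, j)) * F (0, j)| ≤ ε * ∑' x, p x * v x := by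
  have h1 := summable_mul_of_bounded hp hs.summable hF
  have h2 := summable_mul_of_bounded (f := fun x : BlockState d => F (0, x.2)) hp hs.summable
    fun x => hF _
  have h3 : ∑ j, (∑' l : ℕ, p (l, j)) * F (0, j) = ∑' x, p x * F (0, x.2) := by
    rw [tsum_eq_sum_phases h2]
    simp only [tsum_mul_right]
  have hb : ∀ x, |p x * F x - p x * F (0, x.2)| ≤ ε * (p x * v x) := fun x => by
    rw [← mul_sub, abs_mul, abs_of_nonneg (hp x), mul_left_comm]
    exact mul_le_mul_of_nonneg_left (h x) (hp x)
  rw [h3, ← h1.tsum_sub h2, ← tsum_mul_left, ← Real.norm_eq_abs]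
  exact tsum_of_norm_bounded (hpv.mul_left ε).hasSum hb

/-! ### Main theorem -/

/-- One step of `P` and of its truncation, averaged over a stationary vector of `P`. -/
theorem abs_tsum_truncation_step_le {d : ℕ} {P : Matrix (BlockState d) (BlockState d) ℝ}
    {p v F : BlockState d → ℝ} (hP : IsStochastic P) (hp : IsStationaryVector P p)
    (hv : IsBlockIncreasing v) (hv1 : ∀ x, 1 ≤ v x) (hpv : Summable fun x => p x * v x)
    (hF : ∀ x, |F x| ≤ 1) (n : ℕ) :
    |∑' x, p x * rowApply (lastColumnTruncation n P) F x - ∑' x, p x * F x| ≤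
      2 * (∑ i : Fin d, 1 / v (n, i)) * ∑' x, p x * v x := by
  have hFc : ∀ y : BlockState d, |F (min y.1 n, y.2)| ≤ 1 := fun y => hF _
  have h1 : ∑' x, p x * rowApply (lastColumnTruncation n P) F x =
      ∑' x, p x * F (min x.1 n, x.2) := by
    rw [← hp.tsum_rowApply hP hFc]
    exact tsum_congr fun x => by rw [rowApply_lastColumnTruncation hP hF]
  have s1 := summable_mul_of_bounded hp.1 hp.2.1.summable hFc
  have s2 := summable_mul_of_bounded hp.1 hp.2.1.summable hF
  rw [h1, ← s1.tsum_sub s2, ← tsum_mul_left, ← Real.norm_eq_abs]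
  refine tsum_of_norm_bounded (hpv.mul_left _).hasSum fun x => ?_
  rw [← mul_sub, Real.norm_eq_abs, abs_mul, abs_of_nonneg (hp.1 x), mul_left_comm]
  refine mul_le_mul_of_nonneg_left ?_ (hp.1 x)
  have hpos : ∀ y, 0 < v y := fun y => zero_lt_one.trans_le (hv1 y)
  have hnn : ∀ i ∈ Finset.univ, 0 ≤ 1 / v (n, i) := fun i _ => (div_pos one_pos (hpos _)).le
  rcases le_total x.1 n with hx | hx
  · rw [min_eq_left hx, Prod.mk.eta, sub_self, abs_zero]
    exact mul_nonneg (mul_nonneg zero_le_two (Finset.sum_nonneg hnn)) (hpos x).le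
  · have h2 : |F (min x.1 n, x.2) - F x| ≤ 2 :=
      (abs_sub _ _).trans (by linarith [hF x, hFc x])
    have h3 : 1 ≤ 1 / v (n, x.2) * v x := by
      rw [one_div, ← div_eq_inv_mul, one_le_div (hpos _)]
      exact hv.monotone x.2 hx
    have h4 := mul_le_mul_of_nonneg_right
      (Finset.single_le_sum hnn (Finset.mem_univ x.2)) (hpos x).le
    linarith

theorem mainTheorem2 {d : ℕ} (P Pt : Matrix (BlockState d) (BlockState d) ℝ)
    (hP : IsStochastic P)
    (hPt : IsBlockMonotone Pt) (hirr : Pt.IsIrreducible)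
    (hdom : BlockwiseDominated P Pt)
    (v : BlockState d → ℝ) (hv : IsBlockIncreasing v) (hv1 : ∀ x, 1 ≤ v x)
    (γ b : ℝ) (hγ0 : 0 < γ) (hγ1 : γ < 1) (hb : 0 < b)
    (hdrift : GeometricDrift Pt v γ b)
    (p : BlockState d → ℝ) (hp : IsStationaryVector P p)
    (n : ℕ) (hn : 1 ≤ n)
    (pn : BlockState d → ℝ) (hpn : IsStationaryVector (lastColumnTruncation n P) pn)
    (m : ℕ) (hm : 1 ≤ m) :
    tvNorm (pn - p) ≤ b / (1 - γ) * (4 * γ ^ m + 2 * m * ∑ i : Fin d, 1 / v (n, i)) := by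
  have hv0 : ∀ x, 0 ≤ v x := fun x => zero_le_one.trans (hv1 x)
  have mean_le : ∀ {Q : Matrix (BlockState d) (BlockState d) ℝ} {q : BlockState d → ℝ},
      IsStochastic Q → BlockwiseDominated Q Pt → IsStationaryVector Q q →
      (Summable fun x => q x * v x) ∧ ∑' x, q x * v x ≤ b / (1 - γ) := by
    intro Q q hQ hQd hq
    have key := fun x => tsum_mul_le_of_blockTails_le (hQ.1 x) (hPt.1.1 x) (hQ.2 x).summable
      (hPt.1.2 x).summable (hQd x) hv0 hv (hdrift x).1
    refine hq.tsum_le_of_drift hQ hγ0 hγ1 hb hv0 (fun x => (key x).1) fun x =>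
      (key x).2.trans ((hdrift x).2.trans ?_)
    split_ifs <;> linarith
  set Q := lastColumnTruncation n P with hQdef
  have hQ : IsStochastic Q := hP.lastColumnTruncation n
  have hQd : BlockwiseDominated Q Pt := hdom.lastColumnTruncation hP n
  obtain ⟨spv, hpv⟩ := mean_le hP hdom hp
  obtain ⟨snv, hnv⟩ := mean_le hQ hQd hpn
  set f : BlockState d → ℝ := fun x => SignType.sign (pn x - p x) with hfdef
  have hf : ∀ x, |f x| ≤ 1 := fun x => by
    simp only [hfdef]
    rcases SignType.sign (pn x - p x) with _ | _ | _ <;> simp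
  set F : ℕ → BlockState d → ℝ := fun k => (rowApply Q)^[k] f with hFdef
  have hF : ∀ k x, |F k x| ≤ 1 := abs_iterate_rowApply_le hQ hf
  have hFsucc : ∀ k, F (k + 1) = rowApply Q (F k) := fun k =>
    Function.iterate_succ_apply' _ _ _
  have hpnF : ∀ k, ∑' x, pn x * F k x = ∑' x, pn x * f x := by
    intro k
    induction k with
    | zero => rfl
    | succ k ih => rw [hFsucc, hpn.tsum_rowApply hQ (hF k), ih]
  have htv : tvNorm (pn - p) = ∑' x, pn x * f x - ∑' x, p x * f x := by
    rw [← (summable_mul_of_bounded hpn.1 hpn.2.1.summable hf).tsum_sub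
      (summable_mul_of_bounded hp.1 hp.2.1.summable hf)]
    refine tsum_congr fun x => ?_
    rw [← sub_mul, Pi.sub_apply, mul_comm, sign_mul_self]
  set ε := 2 * γ ^ m with hε
  have hε0 : 0 ≤ ε := by positivity
  have hcontr := abs_iterate_rowApply_sub_le hPt hQ hQd hv1 hγ0 hdrift hf m
  have e1 := abs_tsum_mul_sub_level_zero_le hpn.1 hpn.2.1 (hF m) snv hcontr
  have e2 := abs_tsum_mul_sub_level_zero_le hp.1 hp.2.1 (hF m) spv hcontr
  simp only [phase_marginal_unique hPt hirr hP hdom hp hQ hQd hpn] at e2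
  set σ := ∑ i : Fin d, 1 / v (n, i) with hσ
  have hσ0 : 0 ≤ σ := Finset.sum_nonneg fun i _ => div_nonneg zero_le_one (hv0 _)
  have hstep : ∀ k : ℕ, ∑' x, p x * F k x - ∑' x, p x * f x ≤
      k * (2 * σ * (b / (1 - γ))) := by
    intro k
    induction k with
    | zero => simp [hFdef]
    | succ k ih =>
      have h1 := abs_tsum_truncation_step_le hP hp hv hv1 spv (hF k) n
      rw [← hQdef, ← hFsucc] at h1
      have h2 := mul_le_mul_of_nonneg_left hpv (by positivity : 0 ≤ 2 * σ)
      push_cast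
      linarith [(abs_le.1 h1).2]
  have hm' := hstep m
  have h3 := mul_le_mul_of_nonneg_left hpv hε0
  have h4 := mul_le_mul_of_nonneg_left hnv hε0
  have h5 := (abs_le.1 e1).2
  have h6 := (abs_le.1 e2).1
  rw [hpnF m] at h5
  rw [htv]
  calc _ ≤ ε * (b / (1 - γ)) + ε * (b / (1 - γ)) + m * (2 * σ * (b / (1 - γ))) := by linarith
    _ = _ := by rw [hε]; ring
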